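/- All graphs are simple, unweighted and connected, but not necessarily finite; $d$ denotes the shortest-path metric of a graph $G$. For vertices $x,y,u,v$ of $G$ let $\delta_G(x,y,u,v)$ be the difference between the largest and the second largest (counted with multiplicity) of the three numbers $$\frac{d(u,v)+d(x,y)}{2},\qquad \frac{d(u,x)+d(v,y)}{2},\qquad \frac{d(u,y)+d(v,x)}{2}.$$ The graph $G$ is $\delta$-hyperbolic if $\delta_G(x,y,u,v)\le\delta$ for all vertices $x,y,u,v$, and the hyperbolicity of $G$ is the smallest $\delta\in\{0,\tfrac12,1,\tfrac32,\dots\}$ such that $G$ is $\delta$-hyperbolic ($\infty$ if there is none). A subgraph $H$ of $G$ is isometric if $d_H(a,b)=d_G(a,b)$ for all vertices $a,b$ of $H$. An asteroidal triple of $G$ is a set of three vertices such that any two of them are joined by a path all of whose vertices are at distance at least two from the third one, and $G$ is AT-free if it has no asteroidal triple. A graph is a cocomparability graph if its complement is a comparability graph, that is, if there is a partial order on the vertex set for which two distinct vertices are comparable exactly when they are not adjacent in the graph. A graph is a permutation graph if there are two linear orders on its vertex set such that two vertices are adjacent exactly when the two orders order them differently. **Corollary.** Let $G$ be a connected graph.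 1. If $G$ is AT-free, then $G$ is $1$-hyperbolic, and $G$ has hyperbolicity $1$ if and only if it contains the $4$-cycle $C_4$ as an isometric subgraph. 2. If $G$ is a cocomparability graph, then $G$ is $1$-hyperbolic, and $G$ has hyperbolicity $1$ if and only if it contains $C_4$ as an isometric subgraph. 3. If $G$ is a permutation graph, then $G$ is $1$-hyperbolic, and $G$ has hyperbolicity $1$ if and only if it contains $C_4$ as an isometric subgraph. -/

import Mathlib

open scoped ENNReal

namespace SimpleGraph

variable {V : Type*}

/-- The difference between the largest and the second largest (counted with multiplicity) of the
three real numbers `a`, `b`, `c`; the second largest of three numbers is the largest of their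
pairwise minima. -/
noncomputable def topGap (a b c : ℝ) : ℝ :=
  max a (max b c) - max (min a b) (max (min a c) (min b c))

/-- `δ_G(x, y, u, v)` for the shortest-path metric of a connected graph `G`. -/
noncomputable def fourPointDelta (G : SimpleGraph V) (x y u v : V) : ℝ :=
  topGap (((G.dist u v : ℝ) + G.dist x y) / 2)
    (((G.dist u x : ℝ) + G.dist v y) / 2)
    (((G.dist u y : ℝ) + G.dist v x) / 2)

/-- The connected graph `G` is `δ`-hyperbolic. -/
def IsHyperbolic (G : SimpleGraph V) (δ : ℝ) : Prop :=
  ∀ x y u v : V, G.fourPointDelta x y u v ≤ δ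

/-- The hyperbolicity of a connected graph: the least `δ` in `{0, 1/2, 1, 3/2, …}` such that the
graph is `δ`-hyperbolic, and `∞` if there is no such `δ`. -/
noncomputable def hyperbolicity (G : SimpleGraph V) : ℝ≥0∞ :=
  ⨅ (n : ℕ) (_ : G.IsHyperbolic ((n : ℝ) / 2)), (n : ℝ≥0∞) / 2

/-- A subgraph is isometric if distances in it agree with those in the ambient graph. -/
def Subgraph.IsIsometric {G : SimpleGraph V} (H : G.Subgraph) : Prop :=
  ∀ a b : H.verts, H.coe.edist a b = G.edist (a : V) (b : V)

/-- `G` contains (a copy of) `K` as an isometric subgraph. -/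
def ContainsIsometric {W : Type*} (G : SimpleGraph V) (K : SimpleGraph W) : Prop :=
  ∃ H : G.Subgraph, H.IsIsometric ∧ Nonempty (K ≃g H.coe)

/-- There is a path from `a` to `b` all of whose vertices are at distance at least two
from `c`. -/
def HasPathAwayFrom (G : SimpleGraph V) (a b c : V) : Prop :=
  ∃ p : G.Walk a b, p.IsPath ∧ ∀ w ∈ p.support, 2 ≤ G.edist w c

/-- The three vertices `a`, `b`, `c` form an asteroidal triple. -/
def IsAsteroidalTriple (G : SimpleGraph V) (a b c : V) : Prop :=
  a ≠ b ∧ a ≠ c ∧ b ≠ c ∧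
    G.HasPathAwayFrom a b c ∧ G.HasPathAwayFrom a c b ∧ G.HasPathAwayFrom b c a

/-- `G` has no asteroidal triple. -/
def IsATFree (G : SimpleGraph V) : Prop :=
  ∀ a b c : V, ¬ G.IsAsteroidalTriple a b c

/-- `G` is a comparability graph: for some strict partial order on the vertices, two vertices are
adjacent exactly when they are comparable and distinct. -/
def IsComparability (G : SimpleGraph V) : Prop :=
  ∃ r : V → V → Prop, IsStrictOrder V r ∧ ∀ a b, G.Adj a b ↔ r a b ∨ r b a

/-- `G` is a cocomparability graph: its complement is a comparability graph. -/
def IsCocomparability (G : SimpleGraph V) : Prop :=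
  Gᶜ.IsComparability

/-- `G` is a permutation graph: there are two linear orders on the vertices such that two vertices
are adjacent exactly when the two orders order them differently. (For vertices `1, …, n` in their
natural order, the second order is a permutation of `1, …, n`, and the edges are its inversions;
this form also makes sense for infinite graphs.) -/
def IsPermutationGraph (G : SimpleGraph V) : Prop :=
  ∃ r s : V → V → Prop, IsStrictTotalOrder V r ∧ IsStrictTotalOrder V s ∧
    ∀ a b, G.Adj a b ↔ (r a b ∧ s b a) ∨ (r b a ∧ s a b)

end SimpleGraph

/-!
Permutation graphs are cocomparability graphs and these are AT-free, so everything reduces to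
AT-free graphs.

Let `x, u, y, v` be four vertices, thought of as the corners of a geodesic quadrangle with sides
`xu`, `uy`, `yv`, `vx`, and let the sum of the diagonals `d(x, y) + d(u, v)` exceed both sums of
opposite sides by at least `2`. If no geodesic side passes within distance one of a corner that is
not on it, then `{x, u, y}` is an asteroidal triple, the path from `x` to `y` going around
through `v`. On the other hand, if the side `vx` passes within distance one of `u`, the triangle
inequality shows that the excess over `d(x, v) + d(u, y)` is at most `2`
(`dist_add_dist_le_of_near`). So the excess is never `3` or more in an AT-free graph, which is
`1`-hyperbolicity.

If the excess is exactly `2`, take a quadrangle of least perimeter. Cutting off a corner where a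
side comes close shows that such closeness occurs only trivially, at the end of a side that is a
single edge `xu` lying on a geodesic from `x` to `y` and on one from `u` to `v` (`IsRung`,
`isRung_of_near`). As no three corners form an asteroidal triple, every corner lies on such a side
(`exists_isRung_at_corner`), so two opposite sides are of this kind, and the quadrangle is a
`1 × b` rectangle with both diagonals of length `b + 1`. Such a rectangle either has an induced
`4`-cycle at its end, or three vertices near that end form an asteroidal triple
(`exists_square_of_rectangle`). Finally an induced `4`-cycle is isometric, and an isometric `C₄`
has four points with excess `2`.
-/

namespace SimpleGraph

variable {V : Type*} {G : SimpleGraph V}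

/-! ### Permutation and cocomparability graphs are AT-free -/

theorem IsPermutationGraph.isCocomparability (h : G.IsPermutationGraph) :
    G.IsCocomparability := by
  obtain ⟨r, s, hr, hs, h⟩ := h
  refine ⟨fun a b => r a b ∧ s a b, { irrefl := fun a ha => irrefl_of r a ha.1, trans := ?_ }, ?_⟩
  · exact fun a b c hab hbc => ⟨_root_.trans hab.1 hbc.1, _root_.trans hab.2 hbc.2⟩
  · intro a b
    rw [compl_adj, h]
    constructor
    · rintro ⟨hne, hn⟩
      rcases trichotomous_of r a b with h1 | h1 | h1 <;>
      rcases trichotomous_of s a b with h2 | h2 | h2 <;> tauto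
    · intro hab
      refine ⟨?_, ?_⟩
      · rintro rfl
        exact hab.elim (fun h => irrefl_of r a h.1) (fun h => irrefl_of r a h.1)
      · have := fun h h' => asymm_of r (a := a) (b := b) h h'
        have := fun h h' => asymm_of s (a := a) (b := b) h h'
        tauto

/-- A walk from below `c` to above `c` meets the closed neighbourhood of `c`: otherwise all its
vertices are comparable to `c`, so some edge leads from below `c` to above `c`, but the ends of an
edge are incomparable. -/
theorem exists_near_of_between {r : V → V → Prop} [IsStrictOrder V r]
    (h : ∀ a b, Gᶜ.Adj a b ↔ r a b ∨ r b a) {a b c : V} (p : G.Walk a b) (ha : r a c)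
    (hb : r c b) : ∃ w ∈ p.support, ¬ (2 ≤ G.edist w c) := by
  induction p with
  | nil => exact absurd hb (asymm_of r ha)
  | @cons a a' b hadj p ih =>
    have hna : ¬ r a a' := fun h' => ((compl_adj ..).1 ((h a a').2 (.inl h'))).2 hadj
    by_cases hc : Gᶜ.Adj a' c
    · rcases (h a' c).1 hc with h1 | h1
      · obtain ⟨w, hw, hw'⟩ := ih h1 hb
        exact ⟨w, by simp [hw], hw'⟩
      · exact absurd (_root_.trans ha h1) hna
    · refine ⟨a', by simp, fun hd => hc ?_⟩
      refine (compl_adj ..).2 ⟨?_, fun hadj' => ?_⟩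
      · rintro rfl
        simp at hd
      · rw [edist_eq_one_iff_adj.2 hadj'] at hd
        exact absurd hd (by decide)

theorem HasPathAwayFrom.symm {a b c : V} (h : G.HasPathAwayFrom a b c) :
    G.HasPathAwayFrom b a c := by
  obtain ⟨p, hp, h⟩ := h
  exact ⟨p.reverse, hp.reverse, by simpa using h⟩

theorem IsCocomparability.isATFree (h : G.IsCocomparability) : G.IsATFree := by
  obtain ⟨r, hr, h⟩ := h
  have key {a b c : V} (hp : G.HasPathAwayFrom a b c) : ¬ (r a c ∧ r c b) := by
    rintro ⟨ha, hb⟩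
    obtain ⟨p, -, hp⟩ := hp
    obtain ⟨w, hw, hw'⟩ := exists_near_of_between h p ha hb
    exact hw' (hp w hw)
  have cmp {a b c : V} (hp : G.HasPathAwayFrom a b c) (hne : a ≠ c) : r a c ∨ r c a := by
    obtain ⟨p, -, hp⟩ := hp
    refine (h a c).1 ((compl_adj ..).2 ⟨hne, fun hadj => ?_⟩)
    have := hp a p.start_mem_support
    rw [edist_eq_one_iff_adj.2 hadj] at this
    exact absurd this (by decide)
  rintro a b c ⟨hab, hac, hbc, h1, h2, h3⟩
  have k1 := key h1
  have k2 := key h2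
  have k3 := key h3
  have k1' := key h1.symm
  have k2' := key h2.symm
  have k3' := key h3.symm
  have c1 := cmp h1 hac
  have c2 := cmp h2 hab
  have c3 := cmp h1.symm hbc
  tauto

/-! ### Paths away from a vertex -/

theorem HasPathAwayFrom.of_walk {a b c : V} (p : G.Walk a b)
    (h : ∀ w ∈ p.support, 2 ≤ G.edist w c) : G.HasPathAwayFrom a b c := by
  classical
  exact ⟨p.bypass, p.bypass_isPath, fun w hw => h w (p.support_bypass_subset_support hw)⟩

theorem HasPathAwayFrom.trans {a b c z : V} (h₁ : G.HasPathAwayFrom a b z)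
    (h₂ : G.HasPathAwayFrom b c z) : G.HasPathAwayFrom a c z := by
  obtain ⟨p, -, hp⟩ := h₁
  obtain ⟨q, -, hq⟩ := h₂
  refine .of_walk (p.append q) fun w hw => ?_
  rw [Walk.mem_support_append_iff] at hw
  exact hw.elim (hp w) (hq w)

theorem Connected.two_le_edist (hG : G.Connected) {a b : V} (h : 2 ≤ G.dist a b) :
    2 ≤ G.edist a b := by
  rw [← (hG a b).coe_dist_eq_edist]
  exact_mod_cast h

/-- A geodesic from `a` to `b` avoids the closed neighbourhood of `c` if all vertices metrically
between `a` and `b` do. -/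
theorem HasPathAwayFrom.of_between (hG : G.Connected) {a b c : V}
    (h : ∀ w, G.dist a w + G.dist w b = G.dist a b → 2 ≤ G.dist w c) :
    G.HasPathAwayFrom a b c := by
  classical
  obtain ⟨p, hp⟩ := hG.exists_walk_length_eq_dist a b
  refine .of_walk p fun w hw => hG.two_le_edist (h w ?_)
  have h1 := dist_le (p.takeUntil w hw)
  have h2 := dist_le (p.dropUntil w hw)
  have h3 := congrArg Walk.length (p.take_spec hw)
  rw [Walk.length_append] at h3
  have h4 := hG.dist_triangle (u := a) (v := w) (w := b)
  omega

theorem HasPathAwayFrom.of_adj (hG : G.Connected) {a b c : V} (hab : G.Adj a b)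
    (ha : 2 ≤ G.dist a c) (hb : 2 ≤ G.dist b c) : G.HasPathAwayFrom a b c :=
  .of_walk hab.toWalk fun w hw => hG.two_le_edist <| by
    rcases (by simpa using hw : w = a ∨ w = b) with rfl | rfl <;> assumption

theorem Connected.exists_adj_dist (hG : G.Connected) {a b : V} {n : ℕ}
    (h : G.dist a b = n + 1) : ∃ w, G.Adj a w ∧ G.dist w b = n := by
  obtain ⟨p, hp⟩ := hG.exists_walk_length_eq_dist a b
  cases p with
  | nil => simp at h
  | @cons _ w _ hadj p =>
    refine ⟨w, hadj, ?_⟩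
    have h1 := dist_le p
    have h2 := hG.dist_triangle (u := a) (v := w) (w := b)
    have h3 := dist_eq_one_iff_adj.2 hadj
    rw [Walk.length_cons] at hp
    omega

/-! ### Geodesic quadrangles -/

/-- Some vertex metrically between `a` and `b` is within distance one of `c`. -/
def IsNear (G : SimpleGraph V) (a b c : V) : Prop :=
  ∃ w, G.dist a w + G.dist w b = G.dist a b ∧ G.dist w c ≤ 1

/-- The sum of the diagonals `xy` and `uv` of the quadrangle `x, u, y, v` exceeds both sums of
opposite sides by at least `k`. -/
def HasExcess (G : SimpleGraph V) (k : ℕ) (x y u v : V) : Prop :=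
  G.dist x u + G.dist y v + k ≤ G.dist x y + G.dist u v ∧
    G.dist x v + G.dist y u + k ≤ G.dist x y + G.dist u v

/-- The perimeter of the quadrangle `x, u, y, v` with diagonals `xy` and `uv`. -/
noncomputable def perimeter (G : SimpleGraph V) (x y u v : V) : ℕ :=
  G.dist x u + G.dist y v + (G.dist x v + G.dist y u)

/-- The side `xu` of the quadrangle `x, u, y, v` is an edge through which the distances from `x`
to `y` and from `u` to `v` are attained. -/
def IsRung (G : SimpleGraph V) (x u y v : V) : Prop :=
  G.dist x u = 1 ∧ G.dist x y = 1 + G.dist u y ∧ G.dist u v = 1 + G.dist x v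

/-- The graph has an induced `4`-cycle: a closed walk `a, b, c, d` whose opposite vertices are
distinct and not adjacent, that is, at distance at least two. -/
def HasSquare (G : SimpleGraph V) : Prop :=
  ∃ a b c d, G.Adj a b ∧ G.Adj b c ∧ G.Adj c d ∧ G.Adj d a ∧ 2 ≤ G.dist a c ∧ 2 ≤ G.dist b d

theorem IsNear.symm {a b c : V} (h : G.IsNear a b c) : G.IsNear b a c := by
  obtain ⟨w, h1, h2⟩ := h
  refine ⟨w, ?_, h2⟩
  rw [dist_comm, add_comm, dist_comm, h1, dist_comm]

theorem IsRung.symm {x u y v : V} (h : G.IsRung x u y v) : G.IsRung u x v y := by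
  obtain ⟨h1, h2, h3⟩ := h
  exact ⟨by rwa [dist_comm], h3, h2⟩

theorem HasPathAwayFrom.of_not_isNear (hG : G.Connected) {a b c : V} (h : ¬ G.IsNear a b c) :
    G.HasPathAwayFrom a b c :=
  .of_between hG fun w hw => by
    by_contra hlt
    exact h ⟨w, hw, by omega⟩

/-- If the side `vx` comes near the corner `u`, then the excess of the diagonals over
`d(x, v) + d(y, u)` is at most `2`. -/
theorem dist_add_dist_le_of_near (hG : G.Connected) {x u v : V} (y : V)
    (h : G.IsNear v x u) : G.dist x y + G.dist u v ≤ G.dist x v + G.dist y u + 2 := by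
  obtain ⟨w, h1, h2⟩ := h
  have t1 := hG.dist_triangle (u := x) (v := u) (w := y)
  have t2 := hG.dist_triangle (u := x) (v := w) (w := u)
  have t3 := hG.dist_triangle (u := u) (v := w) (w := v)
  simp only [dist_comm (u := v), dist_comm (u := w) (v := x), dist_comm (u := u) (v := w),
    dist_comm (u := u) (v := y)] at *
  simp only [dist_comm (u := w) (v := v)] at *
  omega

theorem HasExcess.swap_left {k : ℕ} {x y u v : V} (h : G.HasExcess k x y u v) :
    G.HasExcess k y x u v := by
  obtain ⟨h1, h2⟩ := h
  have := G.dist_comm (u := x) (v := y)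
  constructor <;> omega

theorem HasExcess.swap_right {k : ℕ} {x y u v : V} (h : G.HasExcess k x y u v) :
    G.HasExcess k x y v u := by
  obtain ⟨h1, h2⟩ := h
  have := G.dist_comm (u := u) (v := v)
  constructor <;> omega

theorem HasExcess.swap_diagonals {k : ℕ} {x y u v : V} (h : G.HasExcess k x y u v) :
    G.HasExcess k u v x y := by
  obtain ⟨h1, h2⟩ := h
  have e1 := G.dist_comm (u := x) (v := u)
  have e2 := G.dist_comm (u := y) (v := v)
  have e3 := G.dist_comm (u := x) (v := v)
  have e4 := G.dist_comm (u := y) (v := u)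
  constructor <;> omega

/-- Either a side not containing `u` comes near `u`, or a side at `u` comes near one of the corners
`x`, `y` off that side: otherwise `x, u, y` form an asteroidal triple, where `x` and `y` are joined
through `v`. -/
theorem exists_near_of_isATFree (hG : G.Connected) (hAT : G.IsATFree) {k : ℕ} {x y u v : V}
    (hk : 2 ≤ k) (h : G.HasExcess k x y u v) :
    (G.IsNear v x u ∨ G.IsNear u y x) ∨ (G.IsNear v y u ∨ G.IsNear u x y) := by
  by_contra! hn
  obtain ⟨⟨h1, h2⟩, h3, h4⟩ := hn
  obtain ⟨e1, e2⟩ := h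
  refine hAT x u y ⟨?_, ?_, ?_, .symm (.of_not_isNear hG h4), .trans
    (.symm (.of_not_isNear hG h1)) (.of_not_isNear hG h3), .of_not_isNear hG h2⟩
  · rintro rfl
    have := G.dist_comm (u := x) (v := y)
    omega
  · rintro rfl
    have := G.dist_comm (u := x) (v := u)
    have := hG.dist_triangle (u := u) (v := x) (w := v)
    simp only [dist_self] at *
    omega
  · rintro rfl
    omega

theorem not_hasExcess_three (hG : G.Connected) (hAT : G.IsATFree) (x y u v : V) :
    ¬ G.HasExcess 3 x y u v := by
  intro h
  have e1 := h
  have e2 := h.swap_left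
  have e3 := h.swap_diagonals
  have e4 := h.swap_diagonals.swap_right
  have c1 := G.dist_comm (u := x) (v := u)
  have c2 := G.dist_comm (u := y) (v := v)
  have c3 := G.dist_comm (u := x) (v := v)
  have c4 := G.dist_comm (u := y) (v := u)
  have c5 := G.dist_comm (u := x) (v := y)
  unfold HasExcess at e1 e2 e3 e4
  rcases exists_near_of_isATFree hG hAT (by norm_num) h with (hn | hn) | hn | hn
  · have := dist_add_dist_le_of_near hG y hn
    omega
  · have := dist_add_dist_le_of_near hG v hn.symm
    omega
  · have := dist_add_dist_le_of_near hG x hn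
    omega
  · have := dist_add_dist_le_of_near hG v hn.symm
    omega

/-! ### Quadrangles of least perimeter -/

/-- If the side `vx` comes near `u` at a vertex `w`, then `w, u, y, v` also has excess `2`, and
its perimeter is smaller unless `w = x`. -/
theorem isRung_of_near (hG : G.Connected) {x y u v : V} (h : G.HasExcess 2 x y u v)
    (hmin : ∀ x', G.HasExcess 2 x' y u v → G.perimeter x y u v ≤ G.perimeter x' y u v)
    (hn : G.IsNear v x u) : G.IsRung x u y v := by
  obtain ⟨w, h1, h2⟩ := hn
  obtain ⟨e1, e2⟩ := h
  have t1 := hG.dist_triangle (u := x) (v := u) (w := y)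
  have t2 := hG.dist_triangle (u := x) (v := w) (w := u)
  have t3 := hG.dist_triangle (u := u) (v := w) (w := v)
  have t4 := hG.dist_triangle (u := x) (v := w) (w := y)
  have c1 := G.dist_comm (u := v) (v := w)
  have c2 := G.dist_comm (u := w) (v := x)
  have c3 := G.dist_comm (u := w) (v := u)
  have c4 := G.dist_comm (u := u) (v := y)
  have c5 := G.dist_comm (u := v) (v := x)
  have hw : G.HasExcess 2 w y u v := by constructor <;> omega
  have := hmin w hw
  unfold perimeter at this
  refine ⟨?_, ?_, ?_⟩ <;> omega

theorem exists_isRung_at_corner (hG : G.Connected) (hAT : G.IsATFree) {x y u v : V}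
    (h : G.HasExcess 2 x y u v)
    (hmin : ∀ x' y' u' v', G.HasExcess 2 x' y' u' v' →
      G.perimeter x y u v ≤ G.perimeter x' y' u' v') :
    G.IsRung x u y v ∨ G.IsRung y u x v := by
  have c1 := G.dist_comm (u := x) (v := u)
  have c2 := G.dist_comm (u := y) (v := v)
  have c3 := G.dist_comm (u := x) (v := v)
  have c4 := G.dist_comm (u := y) (v := u)
  have p1 : G.perimeter y x u v = G.perimeter x y u v := by unfold perimeter; omega
  have p2 : G.perimeter u v x y = G.perimeter x y u v := by unfold perimeter; omega
  have p3 : G.perimeter u v y x = G.perimeter x y u v := by unfold perimeter; omega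
  rcases exists_near_of_isATFree hG hAT le_rfl h with (hn | hn) | hn | hn
  · exact .inl (isRung_of_near hG h (fun x' => hmin x' y u v) hn)
  · exact .inl (isRung_of_near hG h.swap_diagonals
      (fun x' hx => p2.trans_le (hmin _ _ _ _ hx)) hn.symm).symm
  · exact .inr (isRung_of_near hG h.swap_left (fun x' hx => p1.trans_le (hmin _ _ _ _ hx)) hn)
  · exact .inr (isRung_of_near hG h.swap_left.swap_diagonals
      (fun x' hx => p3.trans_le (hmin _ _ _ _ hx)) hn.symm).symm

/-- Let `xu` and `vy` be edges, `d(x, v) = d(u, y) = b` and `d(x, y) = d(u, v) = b + 1`. Take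
geodesics `x, p, p', …, v` and `u, q, …, y`. If `p` and `q` are adjacent, then `x, u, q, p` is an
induced `4`-cycle, and otherwise `x, q, p'` is an asteroidal triple. -/
theorem exists_square_of_rectangle (hG : G.Connected) (hAT : G.IsATFree) {x u y v : V}
    (h₁ : G.IsRung x u y v) (h₂ : G.IsRung y v x u) (hxv : 1 ≤ G.dist x v) : G.HasSquare := by
  obtain ⟨a1, a2, a3⟩ := h₁
  obtain ⟨b1, b2, b3⟩ := h₂
  have cxy := G.dist_comm (u := y) (v := x)
  have cuv := G.dist_comm (u := v) (v := u)
  have cxv := G.dist_comm (u := v) (v := x)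
  have cyu := G.dist_comm (u := y) (v := u)
  have hxu := dist_eq_one_iff_adj.1 a1
  have hyv := dist_eq_one_iff_adj.1 b1
  obtain ⟨b, hb⟩ : ∃ b, G.dist x v = b + 1 := ⟨G.dist x v - 1, by omega⟩
  have hb' : G.dist u y = b + 1 := by omega
  rcases b with _ | b
  · exact ⟨x, u, y, v, hxu, dist_eq_one_iff_adj.1 hb', hyv,
      (dist_eq_one_iff_adj.1 hb).symm, by omega, by omega⟩
  obtain ⟨p, hxp, hpv⟩ := hG.exists_adj_dist hb
  obtain ⟨q, huq, hqy⟩ := hG.exists_adj_dist hb'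
  obtain ⟨p', hpp', hp'v⟩ := hG.exists_adj_dist hpv
  have dhq := dist_eq_one_iff_adj.2 huq
  have tri (a b c : V) := hG.dist_triangle (u := a) (v := b) (w := c)
  have hxq : 2 ≤ G.dist x q := by have := tri x q y; omega
  have hup : 2 ≤ G.dist u p := by have := tri u p v; omega
  by_cases hpq : G.Adj p q
  · exact ⟨x, u, q, p, hxu, huq, hpq.symm, hxp.symm, hxq, hup⟩
  have hpq2 : 2 ≤ G.dist p q := by
    refine hG.one_lt_dist_of_ne_of_not_adj ?_ hpq
    rintro rfl
    have := dist_eq_one_iff_adj.2 hxp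
    omega
  have hqp' : 2 ≤ G.dist q p' := by
    have := tri u q v
    have := tri q p' v
    omega
  have hp'q : 2 ≤ G.dist p' q := by rwa [dist_comm]
  have hxp' : 2 ≤ G.dist x p' := by have := tri x p' v; omega
  have hup' : 2 ≤ G.dist u p' := by have := tri u p' v; omega
  have far_v : ∀ w, G.dist w v ≤ b → 2 ≤ G.dist w x := fun w hw => by
    have := tri x w v
    have := G.dist_comm (u := x) (v := w)
    omega
  have far_y : ∀ w, G.dist w y ≤ b + 1 → 2 ≤ G.dist w x := fun w hw => by
    have := tri x w y
    have := G.dist_comm (u := x) (v := w)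
    omega
  refine (hAT x q p' ⟨?_, ?_, ?_, ?_, ?_, ?_⟩).elim
  · rintro rfl
    simp at hxq
  · rintro rfl
    simp at hxp'
  · rintro rfl
    simp at hqp'
  · exact .trans (.of_adj hG hxu hxp' hup') (.of_adj hG huq hup' hqp')
  · exact .trans (.of_adj hG hxp hxq hpq2) (.of_adj hG hpp' hpq2 hp'q)
  · refine .trans (b := y) (.of_between hG fun w hw => far_y w (by omega)) (.trans (b := v) ?_ ?_)
    · exact .of_adj hG hyv (far_y y (by simp)) (far_v v (by simp))
    · exact .symm (.of_between hG fun w hw => far_v w (by omega))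

theorem hasSquare_of_hasExcess (hG : G.Connected) (hAT : G.IsATFree) {x y u v : V}
    (h : G.HasExcess 2 x y u v) : G.HasSquare := by
  induction hn : G.perimeter x y u v using Nat.strong_induction_on generalizing x y u v with
  | _ n ih =>
  by_contra hS
  have hmin : ∀ x' y' u' v', G.HasExcess 2 x' y' u' v' →
      G.perimeter x y u v ≤ G.perimeter x' y' u' v' := fun x' y' u' v' h' => by
    by_contra! hlt
    exact hS (ih _ (hn ▸ hlt) h' rfl)
  have c1 := G.dist_comm (u := x) (v := u)
  have c2 := G.dist_comm (u := y) (v := v)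
  have c3 := G.dist_comm (u := x) (v := v)
  have c4 := G.dist_comm (u := y) (v := u)
  have c5 := G.dist_comm (u := x) (v := y)
  have p1 : G.perimeter x y v u = G.perimeter x y u v := by unfold perimeter; omega
  have p2 : G.perimeter u v x y = G.perimeter x y u v := by unfold perimeter; omega
  have p3 : G.perimeter u v y x = G.perimeter x y u v := by unfold perimeter; omega
  have ru := exists_isRung_at_corner hG hAT h hmin
  have rv := exists_isRung_at_corner hG hAT h.swap_right
    fun _ _ _ _ h' => p1.trans_le (hmin _ _ _ _ h')
  have rx := exists_isRung_at_corner hG hAT h.swap_diagonals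
    fun _ _ _ _ h' => p2.trans_le (hmin _ _ _ _ h')
  have ry := exists_isRung_at_corner hG hAT h.swap_diagonals.swap_right
    fun _ _ _ _ h' => p3.trans_le (hmin _ _ _ _ h')
  -- Every corner lies on a rung, so there are two opposite rungs.
  have key : (G.IsRung x u y v ∧ G.IsRung y v x u) ∨ (G.IsRung y u x v ∧ G.IsRung x v y u) := by
    by_cases k1 : G.IsRung x u y v
    · by_cases k2 : G.IsRung y v x u
      · exact .inl ⟨k1, k2⟩
      · exact .inr ⟨(ry.resolve_right fun k => k2 k.symm).symm, rv.resolve_right k2⟩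
    · exact .inr ⟨ru.resolve_left k1, (rx.resolve_left fun k => k1 k.symm).symm⟩
  obtain ⟨e1, e2⟩ := h
  rcases key with ⟨k1, k2⟩ | ⟨k1, k2⟩
  · refine hS (exists_square_of_rectangle hG hAT k1 k2 ?_)
    unfold IsRung at k1 k2
    omega
  · refine hS (exists_square_of_rectangle hG hAT k1 k2 ?_)
    unfold IsRung at k1 k2
    omega

/-! ### Hyperbolicity and isometric `4`-cycles -/

theorem lt_topGap_iff {a b c t : ℝ} (ht : 0 ≤ t) : t < topGap a b c ↔
    (b + t < a ∧ c + t < a) ∨ (a + t < b ∧ c + t < b) ∨ (a + t < c ∧ b + t < c) := by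
  unfold topGap
  grind

/-- Failing to be `k/2`-hyperbolic means having four vertices whose excess is
at least `k + 1`. -/
theorem not_isHyperbolic_iff (k : ℕ) : ¬ G.IsHyperbolic ((k : ℝ) / 2) ↔
    ∃ x y u v, G.HasExcess (k + 1) x y u v := by
  have aux {a b c d : ℕ} : ((a : ℝ) + b) / 2 + (k : ℝ) / 2 < ((c : ℝ) + d) / 2 ↔
      a + b + (k + 1) ≤ c + d := by
    rw [← add_div, div_lt_div_iff_of_pos_right two_pos]
    norm_cast
  unfold IsHyperbolic
  push Not
  constructor
  · rintro ⟨x, y, u, v, h⟩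
    rw [fourPointDelta, lt_topGap_iff (by positivity), aux, aux, aux, aux, aux, aux] at h
    have c1 := G.dist_comm (u := x) (v := u)
    have c2 := G.dist_comm (u := y) (v := v)
    have c3 := G.dist_comm (u := x) (v := v)
    have c4 := G.dist_comm (u := y) (v := u)
    have c5 := G.dist_comm (u := x) (v := y)
    rcases h with h | h | h
    · exact ⟨x, y, u, v, by unfold HasExcess; omega⟩
    · exact ⟨u, x, v, y, by unfold HasExcess; omega⟩
    · exact ⟨u, y, v, x, by unfold HasExcess; omega⟩
  · rintro ⟨x, y, u, v, h1, h2⟩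
    refine ⟨x, y, u, v, ?_⟩
    rw [fourPointDelta, lt_topGap_iff (by positivity), aux, aux, aux, aux, aux, aux]
    have c1 := G.dist_comm (u := x) (v := u)
    have c2 := G.dist_comm (u := y) (v := v)
    have c3 := G.dist_comm (u := x) (v := v)
    have c4 := G.dist_comm (u := y) (v := u)
    omega

theorem hyperbolicity_eq_one_iff (h : G.IsHyperbolic 1) :
    G.hyperbolicity = 1 ↔ ¬ G.IsHyperbolic (((1 : ℕ) : ℝ) / 2) := by
  unfold hyperbolicity
  constructor
  · intro h1 h2
    have : (1 : ℝ≥0∞) ≤ ((1 : ℕ) : ℝ≥0∞) / 2 := h1 ▸ iInf₂_le 1 h2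
    rw [ENNReal.le_div_iff_mul_le (by simp) (by simp)] at this
    norm_num at this
  · intro hn
    apply le_antisymm
    · refine (iInf₂_le 2 (by simpa using h)).trans_eq ?_
      exact ENNReal.div_self (by simp) (by simp)
    · refine le_iInf₂ fun n hn' => ?_
      have h2 : 2 ≤ n := by
        by_contra! hlt
        refine hn fun x y u v => (hn' x y u v).trans ?_
        have : (n : ℝ) ≤ (1 : ℕ) := by exact_mod_cast Nat.le_of_lt_succ hlt
        exact div_le_div_of_nonneg_right this zero_le_two
      rw [ENNReal.le_div_iff_mul_le (by simp) (by simp), one_mul]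
      exact_mod_cast h2

theorem HasSquare.containsIsometric (h : G.HasSquare) :
    G.ContainsIsometric (cycleGraph 4) := by
  obtain ⟨a, b, c, d, hab, hbc, hcd, hda, hac, hbd⟩ := h
  have nac : ¬ G.Adj a c := fun h => by rw [dist_eq_one_iff_adj.2 h] at hac; omega
  have nbd : ¬ G.Adj b d := fun h => by rw [dist_eq_one_iff_adj.2 h] at hbd; omega
  have neac : a ≠ c := by rintro rfl; simp at hac
  have nebd : b ≠ d := by rintro rfl; simp at hbd
  have hadj : ∀ i j, G.Adj (![a, b, c, d] i) (![a, b, c, d] j) ↔ (cycleGraph 4).Adj i j := by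
    intro i j
    fin_cases i <;> fin_cases j <;>
      simp [cycleGraph_adj, hab, hbc, hcd, hda, hab.symm, hbc.symm, hcd.symm, hda.symm, nac, nbd,
        G.adj_comm c a, G.adj_comm d b] <;> decide
  have hinj : Function.Injective ![a, b, c, d] := by
    intro i j
    fin_cases i <;> fin_cases j <;>
      simp [hab.ne, hbc.ne, hcd.ne, hda.ne, hab.ne', hbc.ne', hcd.ne', hda.ne', neac, nebd,
        neac.symm, nebd.symm]
  let f : Copy (cycleGraph 4) G := ⟨⟨![a, b, c, d], fun {i j} h => (hadj i j).2 h⟩, hinj⟩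
  refine ⟨f.toSubgraph, fun p q => ?_, ⟨f.isoToSubgraph⟩⟩
  obtain ⟨i, rfl⟩ := f.isoToSubgraph.surjective p
  obtain ⟨j, rfl⟩ := f.isoToSubgraph.surjective q
  have hf : ∀ i, ((f.isoToSubgraph i : f.toSubgraph.verts) : V) = ![a, b, c, d] i := fun _ => rfl
  rw [hf, hf]
  by_cases hij : i = j
  · simp [hij]
  by_cases hA : (cycleGraph 4).Adj i j
  · rw [edist_eq_one_iff_adj.2 ((hadj i j).2 hA),
      edist_eq_one_iff_adj.2 (f.isoToSubgraph.map_adj_iff.2 hA)]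
  · obtain ⟨k, hik, hkj⟩ : ∃ k, (cycleGraph 4).Adj i k ∧ (cycleGraph 4).Adj k j := by
      revert i j
      decide
    rw [edist_eq_two_iff.2 ⟨hinj.ne hij, fun h => hA ((hadj i j).1 h),
        ⟨_, (hadj i k).2 hik, (hadj j k).2 hkj.symm⟩⟩,
      edist_eq_two_iff.2 ⟨f.isoToSubgraph.injective.ne hij,
        fun h => hA (f.isoToSubgraph.map_adj_iff.1 h),
        ⟨_, f.isoToSubgraph.map_adj_iff.2 hik, f.isoToSubgraph.map_adj_iff.2 hkj.symm⟩⟩]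

theorem exists_hasExcess_of_containsIsometric (hG : G.Connected)
    (h : G.ContainsIsometric (cycleGraph 4)) : ∃ x y u v, G.HasExcess 2 x y u v := by
  obtain ⟨H, hH, ⟨φ⟩⟩ := h
  have h1 {i j} (h : (cycleGraph 4).Adj i j) : G.dist (φ i : V) (φ j) = 1 :=
    dist_eq_one_iff_adj.2 (φ.map_adj_iff.2 h).adj_sub
  have h2 {i j} (hne : i ≠ j) (h : ¬ (cycleGraph 4).Adj i j) :
      2 ≤ G.dist (φ i : V) (φ j) := by
    refine hG.one_lt_dist_of_ne_of_not_adj (fun h0 => hne (φ.injective (Subtype.ext h0))) ?_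
    rwa [← edist_eq_one_iff_adj, ← hH, edist_eq_one_iff_adj, φ.map_adj_iff]
  refine ⟨φ 0, φ 2, φ 1, φ 3, ?_⟩
  have a1 := h1 (i := 0) (j := 1) (by decide)
  have a2 := h1 (i := 2) (j := 3) (by decide)
  have a3 := h1 (i := 0) (j := 3) (by decide)
  have a4 := h1 (i := 2) (j := 1) (by decide)
  have b1 := h2 (i := 0) (j := 2) (by decide) (by decide)
  have b2 := h2 (i := 1) (j := 3) (by decide) (by decide)
  constructor <;> omega

theorem IsATFree.isHyperbolic_one_and (hG : G.Connected) (hAT : G.IsATFree) :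
    G.IsHyperbolic 1 ∧ (G.hyperbolicity = 1 ↔ G.ContainsIsometric (cycleGraph 4)) := by
  have h1 : G.IsHyperbolic 1 := by
    by_contra hn
    obtain ⟨x, y, u, v, h⟩ := (not_isHyperbolic_iff 2).1 (by simpa using hn)
    exact not_hasExcess_three hG hAT x y u v h
  refine ⟨h1, ?_⟩
  rw [hyperbolicity_eq_one_iff h1, not_isHyperbolic_iff]
  constructor
  · rintro ⟨x, y, u, v, h⟩
    exact (hasSquare_of_hasExcess hG hAT h).containsIsometric
  · exact exists_hasExcess_of_containsIsometric hG

end SimpleGraph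

theorem mainTheorem6 {V : Type*} (G : SimpleGraph V) (hG : G.Connected) :
    (G.IsATFree → G.IsHyperbolic 1 ∧
      (G.hyperbolicity = 1 ↔ G.ContainsIsometric (SimpleGraph.cycleGraph 4))) ∧
    (G.IsCocomparability → G.IsHyperbolic 1 ∧
      (G.hyperbolicity = 1 ↔ G.ContainsIsometric (SimpleGraph.cycleGraph 4))) ∧
    (G.IsPermutationGraph → G.IsHyperbolic 1 ∧
      (G.hyperbolicity = 1 ↔ G.ContainsIsometric (SimpleGraph.cycleGraph 4))) :=
  ⟨fun h => h.isHyperbolic_one_and hG, fun h => h.isATFree.isHyperbolic_one_and hG,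
    fun h => h.isCocomparability.isATFree.isHyperbolic_one_and hG⟩
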